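/- **Setting.** Let $\varphi(t)=e^{-\pi t^2}$. For $f\in\mathcal S'(\mathbb R)$ the Gabor transform is $$V_\varphi f(x,y)=\big(f,\ \varphi(\cdot-x)\,e^{-2\pi i y\,\cdot}\big)_{\mathcal S'(\mathbb R)\times\mathcal S(\mathbb R)},\qquad (x,y)\in\mathbb R^2,$$ with the bilinear pairing, so that $V_\varphi f(x,y)=\int_{\mathbb R} f(t)\varphi(t-x)e^{-2\pi i y t}\,dt$ for regular $f$. Let $M^{\infty,\infty}(\mathbb R)$ be the set of $f\in\mathcal S'(\mathbb R)$ with $V_\varphi f\in L^\infty(\mathbb R^2)$. Identify $\mathbb R^2$ with $\mathbb C$, let $B_R(z_0)$ be the open Euclidean disc, and for $F:\mathbb R^2\to\mathbb C$ write $\nabla\log F=\big(\tfrac{\partial_xF}{F},\tfrac{\partial_yF}{F}\big)$ (set to $0$ at zeros of $F$) with the Euclidean norm of $\mathbb C^2$. **Proposition.** Let $1\le r<2$. There is a polynomial $\rho$ of degree at most $5$, depending only on $r$, such that for every $f\in M^{\infty,\infty}(\mathbb R)$ with $f\neq0$, every point $z_0=(x_0,y_0)$ at which $|V_\varphi f|$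 attains its maximum over $\mathbb R^2$, and every $R>0$, the following three estimates hold. 1. If $x_0=0$ (in particular if $V_\varphi f$ is centered, i.e. $z_0=0$), then $\|\nabla\log V_\varphi f\|_{L^r(B_R(z_0))}\le\rho(R)$. 2. For arbitrary $z_0$, the function $F(x,y)=e^{2\pi i x_0y}\,V_\varphi f(x,y)$ satisfies $\|\nabla\log F\|_{L^r(B_R(z_0))}\le\rho(R)$. (Up to a unimodular constant, $F$ is the Gabor transform, translated by $z_0$, of the signal $t\mapsto e^{-2\pi i y_0t}f(t+x_0)$ obtained from $f$ by translating and modulating so that the maximum moves to the origin. One has $|F|=|V_\varphi f|$ and $\nabla\log F=\nabla\log V_\varphi f+(0,2\pi i x_0)$ away from the zeros.) 3. For arbitrary $z_0$, $\|\nabla\log|V_\varphi f|\,\|_{L^r(B_R(z_0))}\le\rho(R)$, where $\nabla\log|V_\varphi f|=\nabla|V_\varphi f|/|V_\varphi f|$. -/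

import Mathlib

open scoped SchwartzMap ENNReal

/-- The iterated derivatives of the character `t ↦ e^{-2πiyt}`. -/
theorem iteratedDeriv_timeFreqChar (y : ℝ) (n : ℕ) :
    iteratedDeriv n (fun t : ℝ => Complex.exp (-2 * Real.pi * Complex.I * y * t)) =
      fun t : ℝ => (-2 * Real.pi * Complex.I * y) ^ n *
        Complex.exp (-2 * Real.pi * Complex.I * y * t) := by
  induction n with
  | zero => simp
  | succ n ih =>
    rw [iteratedDeriv_succ, ih]
    funext t
    have h1 : HasDerivAt (fun t : ℝ => -2 * (Real.pi : ℂ) * Complex.I * y * (t : ℂ))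
        (-2 * (Real.pi : ℂ) * Complex.I * y) t := by
      simpa using (Complex.ofRealCLM.hasDerivAt (x := t)).const_mul
        (-2 * (Real.pi : ℂ) * Complex.I * y)
    have h2 := (h1.cexp).const_mul ((-2 * (Real.pi : ℂ) * Complex.I * y) ^ n)
    rw [h2.deriv]
    ring

/-- The character `t ↦ e^{-2πiyt}` has temperate growth, so that Schwartz functions may be
multiplied by it. -/
theorem hasTemperateGrowth_timeFreqChar (y : ℝ) :
    Function.HasTemperateGrowth
      (fun t : ℝ => Complex.exp (-2 * Real.pi * Complex.I * y * t)) := by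
  refine ⟨?_, fun n => ⟨0, ‖(-2 * (Real.pi : ℂ) * Complex.I * y) ^ n‖, fun t => ?_⟩⟩
  · exact (contDiff_const.mul Complex.ofRealCLM.contDiff).cexp
  · rw [norm_iteratedFDeriv_eq_norm_iteratedDeriv, iteratedDeriv_timeFreqChar, norm_mul,
      Complex.norm_exp]
    simp

/-- The derivatives of the Gaussian `e^{-πt²}` are polynomials times the Gaussian. -/
theorem exists_iteratedDeriv_gaussian (n : ℕ) : ∃ P : Polynomial ℝ,
    iteratedDeriv n (fun t : ℝ => ((Real.exp (-Real.pi * t ^ 2) : ℝ) : ℂ)) =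
      fun t : ℝ => ((P.eval t * Real.exp (-Real.pi * t ^ 2) : ℝ) : ℂ) := by
  induction n with
  | zero => exact ⟨1, by simp⟩
  | succ n ih =>
    obtain ⟨P, hP⟩ := ih
    refine ⟨Polynomial.derivative P - Polynomial.C (2 * Real.pi) * Polynomial.X * P, ?_⟩
    rw [iteratedDeriv_succ, hP]
    funext t
    have h1 : HasDerivAt (fun t : ℝ => -Real.pi * t ^ 2) (-Real.pi * (2 * t)) t := by
      simpa using (hasDerivAt_pow 2 t).const_mul (-Real.pi)
    have h2 := ((P.hasDerivAt t).mul h1.exp).ofReal_comp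
    refine h2.deriv.trans ?_
    congr 1
    simp
    ring

/-- A polynomial times the Gaussian `e^{-πt²}` is bounded. -/
theorem exists_bound_polynomial_mul_gaussian (P : Polynomial ℝ) :
    ∃ C : ℝ, ∀ t : ℝ, |P.eval t * Real.exp (-Real.pi * t ^ 2)| ≤ C := by
  induction P using Polynomial.induction_on' with
  | add p q hp hq =>
    obtain ⟨C, hC⟩ := hp
    obtain ⟨D, hD⟩ := hq
    refine ⟨C + D, fun t => ?_⟩
    rw [Polynomial.eval_add, add_mul]
    exact (abs_add_le _ _).trans (add_le_add (hC t) (hD t))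
  | monomial n a =>
    have hcont : Continuous fun t : ℝ => |t| ^ (n : ℝ) * Real.exp (-Real.pi * t ^ 2) := by
      simp only [Real.rpow_natCast]
      fun_prop
    have hev := (tendsto_rpow_abs_mul_exp_neg_mul_sq_cocompact Real.pi_pos (n : ℝ)).eventually
      (gt_mem_nhds one_pos)
    obtain ⟨K, hK, hKc⟩ := Filter.mem_cocompact.1 hev
    obtain ⟨C, hC⟩ := hK.exists_bound_of_continuousOn hcont.continuousOn
    have hmain : ∀ t : ℝ, |t| ^ n * Real.exp (-Real.pi * t ^ 2) ≤ max C 1 := by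
      intro t
      by_cases ht : t ∈ K
      · have := (le_abs_self _).trans (hC t ht)
        simp only [Real.rpow_natCast] at this
        exact this.trans (le_max_left _ _)
      · have := (hKc ht : |t| ^ (n : ℝ) * Real.exp (-Real.pi * t ^ 2) < 1)
        simp only [Real.rpow_natCast] at this
        exact this.le.trans (le_max_right _ _)
    refine ⟨|a| * max C 1, fun t => ?_⟩
    rw [Polynomial.eval_monomial, abs_mul, abs_mul, abs_pow, abs_of_pos (Real.exp_pos _), mul_assoc]
    exact mul_le_mul_of_nonneg_left (hmain t) (abs_nonneg a)

/-- The Gaussian window `φ(t) = e^{-πt²}` as a Schwartz function. -/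
noncomputable def gaussianWindow : 𝓢(ℝ, ℂ) where
  toFun t := ((Real.exp (-Real.pi * t ^ 2) : ℝ) : ℂ)
  smooth' := Complex.ofRealCLM.contDiff.comp
    (Real.contDiff_exp.comp (contDiff_const.mul (contDiff_id.pow 2)))
  decay' k n := by
    obtain ⟨P, hP⟩ := exists_iteratedDeriv_gaussian n
    obtain ⟨C, hC⟩ := exists_bound_polynomial_mul_gaussian (Polynomial.X ^ k * P)
    refine ⟨C, fun t => le_of_eq_of_le ?_ (hC t)⟩
    rw [norm_iteratedFDeriv_eq_norm_iteratedDeriv, hP, Complex.norm_real, Real.norm_eq_abs,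
      Real.norm_eq_abs, Polynomial.eval_mul, Polynomial.eval_pow, Polynomial.eval_X, mul_assoc,
      abs_mul (t ^ k), abs_pow]

theorem gaussianWindow_apply (t : ℝ) :
    gaussianWindow t = ((Real.exp (-Real.pi * t ^ 2) : ℝ) : ℂ) := rfl

/-- The time-frequency shift `t ↦ conj (g (t - x)) · e^{-2πiyt}` of a window `g`, as a Schwartz
function; see `stftAtom_apply`. -/
noncomputable def stftAtom (g : 𝓢(ℝ, ℂ)) (x y : ℝ) : 𝓢(ℝ, ℂ) :=
  SchwartzMap.smulLeftCLM ℂ (fun t : ℝ => Complex.exp (-2 * Real.pi * Complex.I * y * t))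
    (SchwartzMap.compSubConstCLM ℂ x
      (SchwartzMap.postcompCLM (𝕜 := ℝ) (Complex.conjCLE : ℂ →L[ℝ] ℂ) g))

theorem stftAtom_apply (g : 𝓢(ℝ, ℂ)) (x y t : ℝ) :
    stftAtom g x y t =
      (starRingEnd ℂ) (g (t - x)) * Complex.exp (-2 * Real.pi * Complex.I * y * t) := by
  rw [stftAtom, SchwartzMap.smulLeftCLM_apply_apply (hasTemperateGrowth_timeFreqChar y)]
  simp [mul_comm]

/-- The short-time Fourier transform `V_g f(x, y)` of a tempered distribution `f` with window `g`:
the (bilinear) pairing of `f` with `conj (g (· - x)) e^{-2πiy·}`. The time-frequency plane is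
identified with `ℂ` through `(x, y) ↔ x + iy`. -/
noncomputable def stft (g : 𝓢(ℝ, ℂ)) (f : 𝓢'(ℝ, ℂ)) (z : ℂ) : ℂ :=
  f (stftAtom g z.re z.im)

/-- The Gabor transform `V_φ f`, the short-time Fourier transform with Gaussian window. -/
noncomputable def gaborTransform (f : 𝓢'(ℝ, ℂ)) : ℂ → ℂ :=
  stft gaussianWindow f

/-- The modulation space `M^{p,p}(ℝ)`: tempered distributions whose Gabor transform belongs to
`L^p` of the time-frequency plane. -/
def modulationSpace (p : ℝ≥0∞) : Set 𝓢'(ℝ, ℂ) :=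
  {f | MeasureTheory.MemLp (gaborTransform f) p}

/-- The logarithmic gradient `∇ log F = (∂_x F / F, ∂_y F / F)` of a function on the plane, as a
vector of the Hermitian space `ℂ²`. It takes the conventional value `0` at the zeros of `F`. -/
noncomputable def logGradient (F : ℂ → ℂ) (z : ℂ) : EuclideanSpace ℂ (Fin 2) :=
  !₂[fderiv ℝ F z 1 / F z, fderiv ℝ F z Complex.I / F z]

/-!
With `w = x - iy`, the Gabor transform is `e^{-πx²} G(w)`, where `G` is the Bargmann transform
`G(w) = ⟨f, e^{-πt² + 2πtw}⟩` (`gaborTransform_eq`). `G` is entire because the difference quotients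
of `w ↦ e^{-πt² + 2πtw}` converge in the Schwartz topology; Cauchy's estimates reduce this to
pointwise bounds near the real line (`differentiable_apply_gaussianAtom`).

Modulating and recentering at a maximum point `z₀` turns the transform into a constant times
`e^{-π(x - x₀)²} H(conj (z - z₀))` with `H` entire, `‖H 0‖ = 1` and, by maximality,
`‖H ζ‖ ≤ e^{π‖ζ‖²}` (`exists_entire_gaborTransform_eq`). These bounds on `H` involve neither `f` nor
`z₀`, which is the source of the uniformity. The logarithmic gradient is then at most
`2π‖z - z₀‖ + 2‖H'/H‖`, and that of the modulus is no larger, so it remains to estimate `H'/H`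
in `L^r` on the disc of radius `R`.

Replacing the zeros of `H` in the disc of radius `2R` by their reflections in the circle of radius
`4R` keeps the modulus on that circle and at least doubles the modulus at the origin for each zero.
The maximum principle therefore bounds the number of zeros by `O(R²)`, and the Borel–Carathéodory
theorem bounds the logarithmic derivative of the zero-free function that results. Hence `H'/H` is a
sum of `O(R²)` simple poles and an `O(R²)` remainder (`exists_poles_norm_logDeriv_le`). Since
`1/‖z‖` is locally in `L^r` for `r < 2`, with norm `O(R²)` on discs of radius `R ≥ 1` wherever the
pole is, the total is `O(R⁴)`; small radii are covered by using the radius `1 + R`.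
-/

/-! ### Logarithmic derivatives of entire functions of Gaussian growth -/

/-- The function `g · ∏ᵢ (4T² - āᵢ ζ) / (2T)`, obtained from `g · ∏ᵢ (ζ - aᵢ)` by replacing each
factor `ζ - aᵢ` by one with the same modulus on the circle `‖ζ‖ = 2T` and, if
`‖aᵢ‖ < 2T`, no zeros inside. -/
noncomputable def reflectZeros {n : ℕ} (T : ℝ) (a : Fin n → ℂ) (g : ℂ → ℂ) (ζ : ℂ) : ℂ :=
  g ζ * ∏ i, ((4 * T ^ 2 - (starRingEnd ℂ) (a i) * ζ) / (2 * T))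

theorem differentiable_reflectZeros {n : ℕ} {T : ℝ} {a : Fin n → ℂ} {g : ℂ → ℂ}
    (hg : Differentiable ℂ g) : Differentiable ℂ (reflectZeros T a g) := by
  unfold reflectZeros
  fun_prop

/-- The two factors exchanged in `reflectZeros` agree in modulus on the circle of radius `2T`. -/
theorem norm_reflected_factor {T : ℝ} (hT : 0 < T) (a : ℂ) {ζ : ℂ} (hζ : ‖ζ‖ = 2 * T) :
    ‖(4 * (T : ℂ) ^ 2 - (starRingEnd ℂ) a * ζ) / (2 * T)‖ = ‖ζ - a‖ := by
  have h1 : (4 * (T : ℂ) ^ 2) = (starRingEnd ℂ) ζ * ζ := by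
    rw [← Complex.normSq_eq_conj_mul_self, Complex.normSq_eq_norm_sq, hζ]
    push_cast
    ring
  have h2 : ‖(2 * (T : ℂ))‖ = 2 * T := by
    simp [abs_of_pos hT]
  rw [h1, ← sub_mul, ← map_sub, norm_div, norm_mul, Complex.norm_conj, h2, hζ]
  field_simp

theorem norm_reflectZeros_le {n : ℕ} {T M : ℝ} {a : Fin n → ℂ} {g H : ℂ → ℂ} (hT : 0 < T)
    (hg : Differentiable ℂ g) (hH : ∀ ζ, H ζ = (∏ i, (ζ - a i)) * g ζ)
    (hM : ∀ ζ, ‖ζ‖ ≤ 2 * T → ‖H ζ‖ ≤ M) {ζ : ℂ} (hζ : ‖ζ‖ ≤ 2 * T) :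
    ‖reflectZeros T a g ζ‖ ≤ M := by
  refine Complex.norm_le_of_forall_mem_frontier_norm_le (U := Metric.ball 0 (2 * T))
    Metric.isBounded_ball (differentiable_reflectZeros hg).diffContOnCl ?_ ?_
  · intro z hz
    rw [frontier_ball _ (by positivity), mem_sphere_zero_iff_norm] at hz
    refine le_of_eq_of_le ?_ (hM z hz.le)
    rw [reflectZeros, hH, norm_mul, norm_mul, norm_prod, norm_prod, mul_comm]
    congr 1
    exact Finset.prod_congr rfl fun i _ => norm_reflected_factor hT _ hz
  · rw [closure_ball _ (by positivity)]
    simpa using hζ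

/-- Reflecting a zero `a` with `‖a‖ ≤ T` at least doubles the modulus at the origin. -/
theorem two_pow_le_norm_reflectZeros {n : ℕ} {T : ℝ} {a : Fin n → ℂ} {g H : ℂ → ℂ} (hT : 0 < T)
    (ha : ∀ i, ‖a i‖ ≤ T) (hH : ∀ ζ, H ζ = (∏ i, (ζ - a i)) * g ζ) (h0 : ‖H 0‖ = 1) :
    2 ^ n ≤ ‖reflectZeros T a g 0‖ := by
  have h2 : ‖(4 * (T : ℂ) ^ 2) / (2 * (T : ℂ))‖ = 2 * T := by
    have hT' : (T : ℂ) ≠ 0 := by exact_mod_cast hT.ne'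
    have : (4 * (T : ℂ) ^ 2) / (2 * (T : ℂ)) = ((2 * T : ℝ) : ℂ) := by
      push_cast; field_simp; norm_num
    rw [this, Complex.norm_real, Real.norm_of_nonneg (by positivity)]
  have h3 : ∏ i, ‖a i‖ ≤ T ^ n := by
    simpa using Finset.prod_le_prod (s := Finset.univ) (fun i _ => norm_nonneg (a i))
      (fun i _ => ha i)
  have h4 : 1 ≤ T ^ n * ‖g 0‖ := by
    rw [hH, norm_mul, norm_prod] at h0
    simp only [zero_sub, norm_neg] at h0
    rw [← h0]
    gcongr
  rw [reflectZeros, norm_mul, norm_prod]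
  simp only [mul_zero, sub_zero, h2, Finset.prod_const, Finset.card_univ, Fintype.card_fin]
  rw [mul_pow]
  nlinarith [pow_pos (two_pos : (0 : ℝ) < 2) n]

/-- The zeros of an entire function in a disc can be divided out. The process of removing them one
at a time stops because `reflectZeros` bounds their number. -/
theorem exists_zero_free_factorization {T M : ℝ} {H : ℂ → ℂ} (hT : 0 < T)
    (hdiff : Differentiable ℂ H) (hM : ∀ ζ, ‖ζ‖ ≤ 2 * T → ‖H ζ‖ ≤ M) (h0 : ‖H 0‖ = 1) :
    ∃ (n : ℕ) (a : Fin n → ℂ) (g : ℂ → ℂ), (∀ i, ‖a i‖ ≤ T) ∧ Differentiable ℂ g ∧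
      (∀ ζ, H ζ = (∏ i, (ζ - a i)) * g ζ) ∧ ∀ ζ, ‖ζ‖ ≤ T → g ζ ≠ 0 := by
  by_contra hcon
  push Not at hcon
  have key : ∀ n : ℕ, ∃ (a : Fin n → ℂ) (g : ℂ → ℂ), (∀ i, ‖a i‖ ≤ T) ∧ Differentiable ℂ g ∧
      (∀ ζ, H ζ = (∏ i, (ζ - a i)) * g ζ) := by
    intro n
    induction n with
    | zero => exact ⟨Fin.elim0, H, fun i => i.elim0, hdiff, by simp⟩
    | succ n ih =>
      obtain ⟨a, g, ha, hg, hH⟩ := ih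
      obtain ⟨b, hb, hgb⟩ := hcon n a g ha hg hH
      refine ⟨Fin.cons b a, dslope g b, fun i => ?_, ?_, fun ζ => ?_⟩
      · refine Fin.cases ?_ (fun j => ?_) i
        · simpa using hb
        · simpa using ha j
      · rw [← differentiableOn_univ, Complex.differentiableOn_dslope Filter.univ_mem]
        exact hg.differentiableOn
      · have := sub_smul_dslope g b ζ
        rw [hgb, sub_zero, smul_eq_mul] at this
        rw [hH, Fin.prod_univ_succ, ← this]
        simp only [Fin.cons_zero, Fin.cons_succ]
        ring
  obtain ⟨n, hn⟩ := pow_unbounded_of_one_lt M (one_lt_two : (1 : ℝ) < 2)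
  obtain ⟨a, g, ha, hg, hH⟩ := key n
  exact absurd ((two_pow_le_norm_reflectZeros hT ha hH h0).trans
    (norm_reflectZeros_le hT hg hH hM (by simpa using hT.le))) (not_le.2 hn)

/-- A zero-free function on a disc has a holomorphic logarithm whose real part is `log ‖h‖`;
the Borel–Carathéodory theorem and Cauchy's estimate then bound the logarithmic derivative on the
disc of half the radius. -/
theorem norm_logDeriv_le_of_ne_zero {T A : ℝ} {h : ℂ → ℂ} (hT : 0 < T) (hA : 0 < A)
    (hdiff : Differentiable ℂ h) (hne : ∀ ζ, ‖ζ‖ ≤ T → h ζ ≠ 0)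
    (hM : ∀ ζ, ‖ζ‖ ≤ T → ‖h ζ‖ ≤ Real.exp A) (h0 : 1 ≤ ‖h 0‖) {ζ : ℂ} (hζ : ‖ζ‖ ≤ T / 2) :
    ‖logDeriv h ζ‖ ≤ 24 * A / T := by
  have hne' : ∀ z ∈ Metric.ball (0 : ℂ) T, h z ≠ 0 := fun z hz =>
    hne z (mem_ball_zero_iff.1 hz).le
  have hdl : DifferentiableOn ℂ (logDeriv h) (Metric.ball 0 T) :=
    (hdiff.differentiableOn.deriv Metric.isOpen_ball).div hdiff.differentiableOn hne'
  obtain ⟨L, hL0, hL⟩ := hdl.isExactOn_ball.with_val_at 0 0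
  have hLd : DifferentiableOn ℂ L (Metric.ball 0 T) := fun z hz =>
    (hL z hz).differentiableAt.differentiableWithinAt
  -- `h · exp (-L)` has derivative zero, hence is constant
  have hconst : ∀ z ∈ Metric.ball (0 : ℂ) T, h z * Complex.exp (-L z) = h 0 := by
    intro z hz
    have hd : ∀ w ∈ Metric.ball (0 : ℂ) T,
        HasDerivWithinAt (fun w => h w * Complex.exp (-L w)) 0 (Metric.ball 0 T) w := by
      intro w hw
      have h1 := ((hdiff w).hasDerivAt.mul (hL w hw).neg.cexp).hasDerivWithinAt
        (s := Metric.ball 0 T)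
      refine h1.congr_deriv ?_
      rw [logDeriv_apply]
      field_simp [hne' w hw]
      ring
    have hc := (convex_ball (0 : ℂ) T).is_const_of_fderivWithin_eq_zero (𝕜 := ℂ)
      (f := fun w => h w * Complex.exp (-L w))
      (fun w hw => (hd w hw).differentiableWithinAt)
      (fun w hw => by
        have := (hd w hw).hasFDerivWithinAt.fderivWithin
          (Metric.isOpen_ball.uniqueDiffWithinAt hw)
        rw [this]; ext; simp) hz (Metric.mem_ball_self hT)
    simpa [hL0] using hc
  have hre : Set.MapsTo L (Metric.ball 0 T) {z | z.re ≤ A} := by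
    intro z hz
    have h1 := congrArg norm (hconst z hz)
    rw [norm_mul, Complex.norm_exp, Complex.neg_re] at h1
    have h2 : Real.exp (L z).re ≤ Real.exp A := by
      have h3 : Real.exp (L z).re ≤ Real.exp (L z).re * (‖h z‖ * Real.exp (-(L z).re)) := by
        rw [h1]; exact le_mul_of_one_le_right (Real.exp_pos _).le h0
      refine h3.trans (le_trans (le_of_eq ?_) (hM z (mem_ball_zero_iff.1 hz).le))
      rw [Real.exp_neg]
      field_simp
    exact Real.exp_le_exp.1 h2
  have hsub : Metric.closedBall ζ (T / 4) ⊆ Metric.ball (0 : ℂ) T := by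
    intro z hz
    rw [mem_closedBall_iff_norm] at hz
    rw [mem_ball_zero_iff]
    have := norm_le_norm_sub_add z ζ
    linarith
  have hcauchy : ‖deriv L ζ‖ ≤ 6 * A / (T / 4) := by
    refine Complex.norm_deriv_le_of_forall_mem_sphere_norm_le (by positivity)
      ((hLd.mono hsub).diffContOnCl_ball subset_rfl) fun z hz => ?_
    have hzT := hsub (Metric.sphere_subset_closedBall hz)
    have hz' : ‖z‖ ≤ 3 / 4 * T := by
      rw [mem_sphere_iff_norm] at hz
      have := norm_le_norm_sub_add z ζ
      linarith
    refine (Complex.borelCaratheodory_zero hA hLd hre hT hzT hL0).trans ?_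
    rw [div_le_iff₀ (by linarith)]
    nlinarith
  rw [(hL ζ (hsub (Metric.mem_closedBall_self (by positivity)))).deriv] at hcauchy
  refine hcauchy.trans (le_of_eq ?_)
  field_simp
  ring

/-- The logarithmic derivative of an entire function of Gaussian growth on a disc: its at most
`32πR²` nearby zeros contribute simple poles, and the rest is of size `O(R²)`. -/
theorem exists_poles_norm_logDeriv_le {H : ℂ → ℂ} (hdiff : Differentiable ℂ H)
    (hgrowth : ∀ ζ, ‖H ζ‖ ≤ Real.exp (Real.pi * ‖ζ‖ ^ 2)) (h0 : ‖H 0‖ = 1) {R : ℝ} (hR : 1 ≤ R) :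
    ∃ (n : ℕ) (a : Fin n → ℂ), (n : ℝ) ≤ 32 * Real.pi * R ^ 2 ∧
      ∀ ζ, ‖ζ‖ ≤ R → H ζ ≠ 0 →
        ‖logDeriv H ζ‖ ≤ ∑ i, ‖ζ - a i‖⁻¹ + 224 * Real.pi * R ^ 2 := by
  have hpi := Real.pi_pos
  -- zeros are removed on the disc of radius `T`, twice the radius where the estimate is wanted
  set T : ℝ := 2 * R with hTdef
  have hT : 0 < T := by positivity
  set A : ℝ := 4 * Real.pi * T ^ 2 with hAdef
  have hA : 0 < A := by positivity
  have hM : ∀ ζ, ‖ζ‖ ≤ 2 * T → ‖H ζ‖ ≤ Real.exp A := fun ζ hζ => by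
    refine (hgrowth ζ).trans (Real.exp_le_exp.2 ?_)
    have : ‖ζ‖ ^ 2 ≤ (2 * T) ^ 2 := by gcongr
    nlinarith
  obtain ⟨n, a, g, ha, hg, hH, hg0⟩ := exists_zero_free_factorization hT hdiff hM h0
  have hlow := two_pow_le_norm_reflectZeros hT ha hH h0
  have hup : ∀ ζ, ‖ζ‖ ≤ 2 * T → ‖reflectZeros T a g ζ‖ ≤ Real.exp A := fun ζ hζ =>
    norm_reflectZeros_le hT hg hH hM hζ
  have hn : (n : ℝ) ≤ 32 * Real.pi * R ^ 2 := by
    have h1 : (2 : ℝ) ^ n ≤ Real.exp A := hlow.trans (hup 0 (by simpa using hT.le))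
    have h2 := Real.log_le_log (by positivity) h1
    rw [Real.log_pow, Real.log_exp] at h2
    have h3 : (1 / 2 : ℝ) ≤ Real.log 2 := by linarith [Real.log_two_gt_d9]
    have h4 : (n : ℝ) * (1 / 2) ≤ n * Real.log 2 := by gcongr
    rw [hAdef, hTdef] at h2
    nlinarith
  refine ⟨n, a, hn, fun ζ hζ hHζ => ?_⟩
  have hζT : ‖ζ‖ ≤ T := by linarith
  have hTC : (T : ℂ) ≠ 0 := by exact_mod_cast hT.ne'
  have hden : ∀ i, ∀ z, ‖z‖ ≤ T → 3 * T ^ 2 ≤ ‖4 * (T : ℂ) ^ 2 - (starRingEnd ℂ) (a i) * z‖ := by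
    intro i z hz
    have h1 := norm_sub_norm_le (4 * (T : ℂ) ^ 2) ((starRingEnd ℂ) (a i) * z)
    have h2 : ‖4 * (T : ℂ) ^ 2‖ = 4 * T ^ 2 := by simp
    have h3 : ‖(starRingEnd ℂ) (a i) * z‖ ≤ T * T := by
      rw [norm_mul, Complex.norm_conj]
      exact mul_le_mul (ha i) hz (norm_nonneg _) hT.le
    nlinarith
  have hden0 : ∀ i, ∀ z, ‖z‖ ≤ T → 4 * (T : ℂ) ^ 2 - (starRingEnd ℂ) (a i) * z ≠ 0 := by
    intro i z hz h
    have := hden i z hz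
    rw [h, norm_zero] at this
    nlinarith
  have hfac0 : ∀ i, ∀ z, ‖z‖ ≤ T →
      (4 * (T : ℂ) ^ 2 - (starRingEnd ℂ) (a i) * z) / (2 * T) ≠ 0 := fun i z hz =>
    div_ne_zero (hden0 i z hz) (by simpa using hTC)
  have hh : ‖logDeriv (reflectZeros T a g) ζ‖ ≤ 24 * A / T := by
    refine norm_logDeriv_le_of_ne_zero hT hA (differentiable_reflectZeros hg) (fun z hz => ?_)
      (fun z hz => hup z (by linarith)) ((one_le_pow₀ one_le_two).trans hlow) (by linarith)
    exact mul_ne_zero (hg0 z hz) (Finset.prod_ne_zero_iff.2 fun i _ => hfac0 i z hz)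
  have hζa : ∀ i ∈ Finset.univ, ζ - a i ≠ 0 := by
    rw [hH] at hHζ
    exact Finset.prod_ne_zero_iff.1 (left_ne_zero_of_mul hHζ)
  have e1 : logDeriv H ζ = ∑ i, (ζ - a i)⁻¹ + logDeriv g ζ := by
    rw [show H = fun z => (∏ i, (z - a i)) * g z from funext hH,
      logDeriv_mul ζ (Finset.prod_ne_zero_iff.2 hζa) (hg0 ζ hζT) (by fun_prop) (hg ζ)]
    rw [logDeriv_prod hζa (fun i _ => by fun_prop)]
    congr 1
    refine Finset.sum_congr rfl fun i _ => ?_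
    rw [logDeriv_apply, deriv_sub_const, deriv_id'', one_div]
  have e2 : logDeriv (reflectZeros T a g) ζ = logDeriv g ζ +
      ∑ i, (-(starRingEnd ℂ) (a i)) / (4 * (T : ℂ) ^ 2 - (starRingEnd ℂ) (a i) * ζ) := by
    unfold reflectZeros
    rw [logDeriv_mul ζ (hg0 ζ hζT) (Finset.prod_ne_zero_iff.2 fun i _ => hfac0 i ζ hζT) (hg ζ)
      (by fun_prop)]
    rw [logDeriv_prod (f := fun i z => (4 * (T : ℂ) ^ 2 - (starRingEnd ℂ) (a i) * z) / (2 * T))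
      (fun i _ => hfac0 i ζ hζT) (fun i _ => by fun_prop)]
    congr 1
    refine Finset.sum_congr rfl fun i _ => ?_
    have hd : HasDerivAt
        (fun z : ℂ => (4 * (T : ℂ) ^ 2 - (starRingEnd ℂ) (a i) * z) / (2 * T))
        (-(starRingEnd ℂ) (a i) / (2 * T)) ζ := by
      simpa using (((hasDerivAt_id ζ).const_mul ((starRingEnd ℂ) (a i))).const_sub
        (4 * (T : ℂ) ^ 2)).div_const (2 * (T : ℂ))
    rw [logDeriv_apply, hd.deriv]
    have := hden0 i ζ hζT
    field_simp
  have e3 : ‖∑ i, (-(starRingEnd ℂ) (a i)) / (4 * (T : ℂ) ^ 2 - (starRingEnd ℂ) (a i) * ζ)‖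
      ≤ n := by
    refine (norm_sum_le_of_le (f := fun i => (-(starRingEnd ℂ) (a i)) /
      (4 * (T : ℂ) ^ 2 - (starRingEnd ℂ) (a i) * ζ)) Finset.univ (n := fun _ => (1 : ℝ))
      fun i _ => ?_).trans (by simp)
    rw [norm_div, norm_neg, Complex.norm_conj]
    refine div_le_one_of_le₀ ((ha i).trans (le_trans ?_ (hden i ζ hζT))) (norm_nonneg _)
    nlinarith
  have e4 : ‖∑ i, (ζ - a i)⁻¹‖ ≤ ∑ i, ‖ζ - a i‖⁻¹ :=
    norm_sum_le_of_le _ fun i _ => (norm_inv _).le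
  have e5 : logDeriv H ζ = ∑ i, (ζ - a i)⁻¹ + (logDeriv (reflectZeros T a g) ζ -
      ∑ i, (-(starRingEnd ℂ) (a i)) / (4 * (T : ℂ) ^ 2 - (starRingEnd ℂ) (a i) * ζ)) := by
    rw [e1, e2]; ring
  have e6 : 24 * A / T = 192 * Real.pi * R := by
    rw [hAdef, hTdef]; field_simp; ring
  rw [e5]
  refine (norm_add_le _ _).trans (add_le_add e4 ((norm_sub_le _ _).trans ?_))
  rw [e6] at hh
  nlinarith [mul_le_mul_of_nonneg_left hR (mul_nonneg hpi.le (zero_le_one.trans hR))]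

/-! ### The Bargmann transform of a tempered distribution -/

theorem iteratedDeriv_comp_ofReal {ψ : ℂ → ℂ} (hψ : Differentiable ℂ ψ) (n : ℕ) :
    iteratedDeriv n (fun t : ℝ => ψ t) = fun t : ℝ => iteratedDeriv n ψ t := by
  induction n with
  | zero => simp
  | succ n ih =>
    rw [iteratedDeriv_succ, ih, iteratedDeriv_succ]
    funext t
    have hd : Differentiable ℂ (iteratedDeriv n ψ) :=
      hψ.contDiff.differentiable_iteratedDeriv n (WithTop.coe_lt_top _)
    exact (hd t).hasDerivAt.comp_ofReal.deriv

/-- Cauchy's estimates on unit discs bound the Schwartz seminorms of the restriction to `ℝ` of an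
entire function by its size near the real line. -/
theorem seminorm_le_of_entire {ψ : ℂ → ℂ} (hψ : Differentiable ℂ ψ) (F : 𝓢(ℝ, ℂ))
    (hF : ∀ t : ℝ, F t = ψ t) {k : ℕ} (n : ℕ) {C : ℝ}
    (hC : ∀ (t : ℝ) (s : ℂ), ‖s - t‖ ≤ 1 → |t| ^ k * ‖ψ s‖ ≤ C) :
    SchwartzMap.seminorm ℂ k n F ≤ n.factorial * C := by
  have hC0 : 0 ≤ C := le_trans (by positivity) (hC 0 0 (by simp))
  refine SchwartzMap.seminorm_le_bound' ℂ k n F (by positivity) fun t => ?_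
  rw [show (F : ℝ → ℂ) = fun t : ℝ => ψ t from funext hF, iteratedDeriv_comp_ofReal hψ,
    ← abs_of_nonneg (pow_nonneg (abs_nonneg t) k), ← Real.norm_eq_abs, ← Complex.norm_real,
    ← norm_mul]
  set c : ℂ := ((|t| ^ k : ℝ) : ℂ)
  have h1 : c * iteratedDeriv n ψ t = iteratedDeriv n (fun s => c * ψ s) t :=
    (iteratedDeriv_const_mul_field c ψ).symm
  rw [h1]
  refine (Complex.norm_iteratedDeriv_le_of_forall_mem_sphere_norm_le (C := C) n one_pos
    (hψ.const_mul c).diffContOnCl fun s hs => ?_).trans (by simp)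
  rw [norm_mul, Complex.norm_real, Real.norm_of_nonneg (by positivity)]
  exact hC t s (mem_sphere_iff_norm.1 hs).le

/-- The Schwartz function `t ↦ e^{-πt² + 2πtw}`: up to a positive constant, the time-frequency
shift of the Gaussian by `w.re` in time and `-w.im` in frequency. It is entire in `w`. -/
noncomputable def gaussianAtom (w : ℂ) : 𝓢(ℝ, ℂ) :=
  (Real.exp (Real.pi * w.re ^ 2) : ℂ) • stftAtom gaussianWindow w.re (-w.im)

theorem gaussianAtom_apply (w : ℂ) (t : ℝ) :
    gaussianAtom w t = Complex.exp (-Real.pi * t ^ 2 + 2 * Real.pi * t * w) := by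
  rw [gaussianAtom, smul_apply, stftAtom_apply, gaussianWindow_apply,
    Complex.conj_ofReal, smul_eq_mul]
  push_cast
  rw [← Complex.exp_add, ← Complex.exp_add]
  congr 1
  conv_rhs => rw [← Complex.re_add_im w]
  ring

/-- The derivative `t ↦ 2πt e^{-πt² + 2πtw}` of `gaussianAtom` with respect to `w`. -/
noncomputable def gaussianAtomDeriv (w : ℂ) : 𝓢(ℝ, ℂ) :=
  SchwartzMap.smulLeftCLM ℂ (fun t : ℝ => 2 * Real.pi * t) (gaussianAtom w)

theorem gaussianAtomDeriv_apply (w : ℂ) (t : ℝ) :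
    gaussianAtomDeriv w t =
      2 * Real.pi * t * Complex.exp (-Real.pi * t ^ 2 + 2 * Real.pi * t * w) := by
  rw [gaussianAtomDeriv, SchwartzMap.smulLeftCLM_apply_apply (by fun_prop), gaussianAtom_apply]
  simp

/-- Rapid decay, near the real line, of the remainder of the difference quotient in `w` of
`e^{-πs² + 2πsw}`: it is `O(‖h‖)` even after multiplication by a power of `t`. -/
theorem pow_mul_norm_remainder_le (w : ℂ) (k : ℕ) {h : ℂ} (h0 : h ≠ 0) (h1 : ‖h‖ ≤ 1) (t : ℝ)
    (s : ℂ) (hs : ‖s - t‖ ≤ 1) :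
    |t| ^ k * ‖h⁻¹ * (Complex.exp (-Real.pi * s ^ 2 + 2 * Real.pi * s * w) *
      (Complex.exp (2 * Real.pi * s * h) - 1 - 2 * Real.pi * s * h))‖ ≤
    ((2 * Real.pi) ^ 2 * (k + 2).factorial * Real.exp ((2 * Real.pi * ‖w‖ + 2 * Real.pi + 1) +
      (2 * Real.pi * ‖w‖ + 2 * Real.pi + 1) ^ 2 + 2 * Real.pi)) * ‖h‖ := by
  have hpi := Real.pi_pos
  have hpi3 := Real.pi_gt_three
  set B : ℝ := 2 * Real.pi * ‖w‖ + 2 * Real.pi + 1 with hB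
  have hB0 : 0 ≤ B := by positivity
  set x : ℝ := |t| + 1 with hx
  have hx0 : 0 < x := by positivity
  have hsx : ‖s‖ ≤ x := by
    have := norm_le_norm_sub_add s t
    rw [Complex.norm_real, Real.norm_eq_abs] at this
    linarith
  have e1 : ‖Complex.exp (-Real.pi * s ^ 2 + 2 * Real.pi * s * w)‖ ≤
      Real.exp (-Real.pi * |t| ^ 2 / 2 + 2 * Real.pi + 2 * Real.pi * x * ‖w‖) := by
    rw [Complex.norm_exp]
    refine Real.exp_le_exp.2 ?_
    rw [Complex.add_re]
    refine add_le_add ?_ ?_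
    · have hre := (Complex.abs_re_le_norm (s - t)).trans hs
      have him := (Complex.abs_im_le_norm (s - t)).trans hs
      simp only [Complex.sub_re, Complex.ofReal_re, Complex.sub_im, Complex.ofReal_im,
        sub_zero] at hre him
      have e : (-(Real.pi : ℂ) * s ^ 2).re = -Real.pi * (s.re ^ 2 - s.im ^ 2) := by
        simp [pow_two]
      rw [e, sq_abs]
      have a1 : (s.re - t) ^ 2 ≤ 1 := by rw [← sq_abs]; nlinarith [abs_nonneg (s.re - t)]
      have a2 : s.im ^ 2 ≤ 1 := by rw [← sq_abs]; nlinarith [abs_nonneg s.im]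
      have a3 : t ^ 2 / 2 - 2 ≤ s.re ^ 2 - s.im ^ 2 := by
        nlinarith [sq_nonneg (2 * s.re - t)]
      nlinarith
    · refine (Complex.re_le_norm _).trans ?_
      simp only [norm_mul, Complex.norm_real, Complex.norm_ofNat, Real.norm_of_nonneg hpi.le]
      gcongr
  have e2 : ‖Complex.exp (2 * Real.pi * s * h) - 1 - 2 * Real.pi * s * h‖ ≤
      (2 * Real.pi * x * ‖h‖) ^ 2 * Real.exp (2 * Real.pi * x) := by
    have := Complex.norm_exp_sub_sum_le_norm_mul_exp (2 * Real.pi * s * h) 2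
    simp only [Finset.sum_range_succ, Finset.sum_range_zero, pow_zero, Nat.factorial_zero,
      Nat.cast_one, div_one, zero_add, pow_one, Nat.factorial_one, ← sub_sub] at this
    refine this.trans ?_
    have e : ‖2 * (Real.pi : ℂ) * s * h‖ ≤ 2 * Real.pi * x * ‖h‖ := by
      simp only [norm_mul, Complex.norm_real, Complex.norm_ofNat, Real.norm_of_nonneg hpi.le]
      gcongr
    gcongr
    exact e.trans (mul_le_of_le_one_right (by positivity) h1)
  have e3 : |t| ^ k * x ^ 2 ≤ (k + 2).factorial * Real.exp x := by
    have := Real.pow_div_factorial_le_exp x hx0.le (k + 2)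
    rw [div_le_iff₀ (by positivity)] at this
    calc |t| ^ k * x ^ 2 ≤ x ^ k * x ^ 2 := by gcongr; rw [hx]; linarith
      _ = x ^ (k + 2) := by ring
      _ ≤ _ := by linarith
  have hh : 0 < ‖h‖ := norm_pos_iff.2 h0
  rw [norm_mul, norm_mul, norm_inv]
  calc |t| ^ k * (‖h‖⁻¹ * (‖Complex.exp (-Real.pi * s ^ 2 + 2 * Real.pi * s * w)‖ *
        ‖Complex.exp (2 * Real.pi * s * h) - 1 - 2 * Real.pi * s * h‖))
      ≤ |t| ^ k * (‖h‖⁻¹ *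
        (Real.exp (-Real.pi * |t| ^ 2 / 2 + 2 * Real.pi + 2 * Real.pi * x * ‖w‖) *
        ((2 * Real.pi * x * ‖h‖) ^ 2 * Real.exp (2 * Real.pi * x)))) := by gcongr
    _ = (2 * Real.pi) ^ 2 * ‖h‖ * (|t| ^ k * x ^ 2) *
        (Real.exp (-Real.pi * |t| ^ 2 / 2 + 2 * Real.pi + 2 * Real.pi * x * ‖w‖) *
          Real.exp (2 * Real.pi * x)) := by field_simp
    _ ≤ (2 * Real.pi) ^ 2 * ‖h‖ * ((k + 2).factorial * Real.exp x) *
        (Real.exp (-Real.pi * |t| ^ 2 / 2 + 2 * Real.pi + 2 * Real.pi * x * ‖w‖) *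
          Real.exp (2 * Real.pi * x)) := by gcongr
    _ = (2 * Real.pi) ^ 2 * (k + 2).factorial * ‖h‖ *
        Real.exp (-Real.pi * |t| ^ 2 / 2 + 2 * Real.pi + B * x) := by
      have : -Real.pi * |t| ^ 2 / 2 + 2 * Real.pi + B * x = x +
        ((-Real.pi * |t| ^ 2 / 2 + 2 * Real.pi + 2 * Real.pi * x * ‖w‖) + 2 * Real.pi * x) := by
        rw [hB]; ring
      rw [this, Real.exp_add x, Real.exp_add _ (2 * Real.pi * x)]
      ring
    _ ≤ (2 * Real.pi) ^ 2 * (k + 2).factorial * ‖h‖ *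
        Real.exp (B + B ^ 2 + 2 * Real.pi) := by
      refine mul_le_mul_of_nonneg_left (Real.exp_le_exp.2 ?_) (by positivity)
      have : B * x = B * |t| + B := by rw [hx]; ring
      nlinarith [sq_nonneg (|t| - B), sq_nonneg |t|]
    _ = _ := by ring

/-- The Bargmann transform `w ↦ ⟨f, e^{-πt² + 2πtw}⟩` of a tempered distribution is entire: the
difference quotients of `gaussianAtom` converge in the Schwartz topology. -/
theorem differentiable_apply_gaussianAtom (f : 𝓢'(ℝ, ℂ)) :
    Differentiable ℂ fun w => f (gaussianAtom w) := by
  intro w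
  have hlim : Filter.Tendsto (fun h : ℂ => h⁻¹ • (gaussianAtom (w + h) - gaussianAtom w))
      (nhdsWithin 0 {0}ᶜ) (nhds (gaussianAtomDeriv w)) := by
    refine ((schwartz_withSeminorms ℂ ℝ ℂ).tendsto_nhds _ _).2 fun ⟨k, n⟩ ε hε => ?_
    set C : ℝ := (2 * Real.pi) ^ 2 * (k + 2).factorial *
      Real.exp ((2 * Real.pi * ‖w‖ + 2 * Real.pi + 1) +
      (2 * Real.pi * ‖w‖ + 2 * Real.pi + 1) ^ 2 + 2 * Real.pi) with hC
    have hsmall : Filter.Tendsto (fun h : ℂ => n.factorial * (C * ‖h‖))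
        (nhdsWithin 0 {0}ᶜ) (nhds 0) := by
      have : Continuous fun h : ℂ => n.factorial * (C * ‖h‖) := by fun_prop
      simpa using (this.tendsto 0).mono_left nhdsWithin_le_nhds
    have hone : ∀ᶠ h : ℂ in nhdsWithin 0 {0}ᶜ, ‖h‖ ≤ 1 := by
      refine nhdsWithin_le_nhds ?_
      filter_upwards [Metric.closedBall_mem_nhds (0 : ℂ) one_pos] with h hh
      simpa using hh
    filter_upwards [hsmall.eventually (gt_mem_nhds hε), hone, self_mem_nhdsWithin]
      with h hhε hh1 hh0
    have hh0' : h ≠ 0 := hh0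
    refine lt_of_le_of_lt ?_ hhε
    refine seminorm_le_of_entire (ψ := fun s => h⁻¹ *
      (Complex.exp (-Real.pi * s ^ 2 + 2 * Real.pi * s * w) *
      (Complex.exp (2 * Real.pi * s * h) - 1 - 2 * Real.pi * s * h))) (by fun_prop) _
      (fun t => ?_) n (fun t s hs => pow_mul_norm_remainder_le w k hh0' hh1 t s hs)
    simp only [sub_apply, smul_apply, gaussianAtom_apply,
      gaussianAtomDeriv_apply, smul_eq_mul]
    rw [mul_add, ← add_assoc, Complex.exp_add _ (2 * Real.pi * t * h)]
    field_simp
  refine HasDerivAt.differentiableAt (f' := f (gaussianAtomDeriv w)) ?_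
  rw [hasDerivAt_iff_tendsto_slope_zero]
  refine ((map_continuous f).tendsto _ |>.comp hlim).congr fun h => ?_
  simp

/-- The Gabor transform is, up to the weight `e^{-πx²}`, an entire function of `x - iy`. -/
theorem gaborTransform_eq (f : 𝓢'(ℝ, ℂ)) (z : ℂ) :
    gaborTransform f z = Real.exp (-Real.pi * z.re ^ 2) *
      f (gaussianAtom ((starRingEnd ℂ) z)) := by
  rw [gaussianAtom, map_smul, smul_eq_mul, ← mul_assoc]
  simp only [Complex.conj_re, Complex.conj_im, neg_neg]
  rw [← Complex.ofReal_mul, ← Real.exp_add]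
  simp [gaborTransform, stft]

/-! ### Simple poles in `L^r` -/

open MeasureTheory in
theorem eLpNorm_one_ball_le {r : ℝ} (hr1 : 1 ≤ r) (z₀ : ℂ) {R : ℝ} (hR : 1 ≤ R) :
    eLpNorm (fun _ : ℂ => (1 : ℝ)) (ENNReal.ofReal r) (volume.restrict (Metric.ball z₀ R)) ≤
      ENNReal.ofReal (Real.pi * R ^ 2) := by
  have hr0 : 0 < r := by linarith
  have h1 : 1 ≤ Real.pi * R ^ 2 := by nlinarith [Real.pi_gt_three]
  have h2 : volume (Metric.ball z₀ R) = ENNReal.ofReal (Real.pi * R ^ 2) := by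
    rw [Complex.volume_ball, ENNReal.ofReal_mul Real.pi_pos.le, mul_comm,
      ENNReal.ofReal_pow (by linarith)]
    congr 1
    rw [← NNReal.coe_real_pi, ENNReal.ofReal_coe_nnreal]
  rw [eLpNorm_const' _ (by simpa using hr0) ENNReal.ofReal_ne_top, enorm_one, one_mul,
    Measure.restrict_apply_univ, h2, ENNReal.toReal_ofReal hr0.le]
  refine (ENNReal.rpow_le_rpow_of_exponent_le (ENNReal.one_le_ofReal.2 h1)
    ((div_le_one hr0).2 hr1)).trans (by rw [ENNReal.rpow_one])

open MeasureTheory in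
/-- In the plane `‖·‖⁻¹` is locally in `L^r` for `r < 2`, uniformly in the position of the pole. -/
theorem exists_eLpNorm_inv_norm_sub_le {r : ℝ} (hr1 : 1 ≤ r) (hr2 : r < 2) :
    ∃ A : ℝ, 0 ≤ A ∧ ∀ (b z₀ : ℂ) (R : ℝ), 1 ≤ R →
      eLpNorm (fun z : ℂ => ‖z - b‖⁻¹) (ENNReal.ofReal r)
        (volume.restrict (Metric.ball z₀ R)) ≤ ENNReal.ofReal (A + Real.pi * R ^ 2) := by
  have hr0 : 0 < r := by linarith
  set u : ℂ → ℝ := (Metric.ball (0 : ℂ) 1).indicator (fun z => ‖z‖⁻¹) with hu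
  have humeas : Measurable u :=
    (measurable_norm.inv).indicator Metric.isOpen_ball.measurableSet
  have hfin : MemLp u (ENNReal.ofReal r) := by
    rw [hu, memLp_indicator_iff_restrict Metric.isOpen_ball.measurableSet]
    refine (integrable_norm_rpow_iff measurable_norm.inv.aestronglyMeasurable
      (by simpa using hr0) ENNReal.ofReal_ne_top).1 ?_
    rw [ENNReal.toReal_ofReal hr0.le]
    have h1 : IntegrableOn (fun z : ℂ => (fun x : ℝ => x ^ (-r)) ‖z‖) (Metric.ball 0 1) := by
      refine (integrableOn_fun_norm_addHaar (μ := volume) (f := fun x : ℝ => x ^ (-r))).2 ?_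
      have h2 : IntegrableOn (fun y : ℝ => y ^ (1 - r)) (Set.Ioo 0 1) :=
        (intervalIntegral.integrableOn_Ioo_rpow_iff one_pos).2 (by linarith)
      refine h2.congr_fun (fun y hy => ?_) measurableSet_Ioo
      change y ^ (1 - r) = _
      rw [Complex.finrank_real_complex, smul_eq_mul, sub_eq_add_neg, Real.rpow_add hy.1]
      simp
    refine h1.congr_fun (fun z _ => ?_) Metric.isOpen_ball.measurableSet
    simp [Real.rpow_neg (norm_nonneg z), Real.inv_rpow (norm_nonneg z)]
  refine ⟨(eLpNorm u (ENNReal.ofReal r)).toReal, ENNReal.toReal_nonneg, fun b z₀ R hR => ?_⟩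
  have hle : ∀ z : ℂ, ‖‖z - b‖⁻¹‖ ≤ ((u ∘ (· - b)) + fun _ : ℂ => (1 : ℝ)) z := by
    intro z
    rw [norm_inv, norm_norm, Pi.add_apply, Function.comp_apply, hu]
    by_cases hz : z - b ∈ Metric.ball (0 : ℂ) 1
    · rw [Set.indicator_of_mem hz]
      linarith
    · rw [Set.indicator_of_notMem hz, zero_add]
      rw [mem_ball_zero_iff, not_lt] at hz
      exact inv_le_one_of_one_le₀ hz
  have hcomp : Measurable (u ∘ (· - b)) := humeas.comp (measurable_id.sub_const b)
  refine (eLpNorm_mono_ae_real (Filter.Eventually.of_forall hle)).trans ?_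
  refine (eLpNorm_add_le hcomp.aestronglyMeasurable aestronglyMeasurable_const
    (ENNReal.one_le_ofReal.2 hr1)).trans ?_
  rw [ENNReal.ofReal_add ENNReal.toReal_nonneg (by positivity)]
  refine add_le_add ?_ (eLpNorm_one_ball_le hr1 z₀ hR)
  rw [ENNReal.ofReal_toReal hfin.eLpNorm_ne_top]
  refine (eLpNorm_mono_measure _ Measure.restrict_le_self).trans (le_of_eq ?_)
  exact eLpNorm_comp_measurePreserving humeas.aestronglyMeasurable
    (measurePreserving_sub_right volume b)

open MeasureTheory in
/-- The `L^r` norm of a function which has `O(R²)` simple poles on a disc of radius `R`, and which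
is otherwise of size `O(R²)`, is `O(R⁴)`. -/
theorem eLpNorm_le_of_poles {E : Type*} [NormedAddCommGroup E] {r A : ℝ} (hr1 : 1 ≤ r)
    (hA0 : 0 ≤ A)
    (hA : ∀ (b z₀ : ℂ) (R : ℝ), 1 ≤ R → eLpNorm (fun z : ℂ => ‖z - b‖⁻¹) (ENNReal.ofReal r)
      (volume.restrict (Metric.ball z₀ R)) ≤ ENNReal.ofReal (A + Real.pi * R ^ 2))
    {u : ℂ → E} {z₀ : ℂ} {R : ℝ} (hR : 1 ≤ R) {n : ℕ} (hn : (n : ℝ) ≤ 32 * Real.pi * R ^ 2)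
    (b : Fin n → ℂ)
    (hu : ∀ z ∈ Metric.ball z₀ R, ‖u z‖ ≤ 2 * ∑ i, ‖z - b i‖⁻¹ + 450 * Real.pi * R ^ 2) :
    eLpNorm u (ENNReal.ofReal r) (volume.restrict (Metric.ball z₀ R)) ≤
      ENNReal.ofReal (Real.pi * (64 * A + 514 * Real.pi) * R ^ 4) := by
  have hpi := Real.pi_pos
  set μ := volume.restrict (Metric.ball z₀ R)
  have hp : 1 ≤ ENNReal.ofReal r := ENNReal.one_le_ofReal.2 hr1
  have hmeas : ∀ i, Measurable fun z : ℂ => ‖z - b i‖⁻¹ := fun i => by fun_prop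
  have h1 : eLpNorm u (ENNReal.ofReal r) μ ≤ eLpNorm
      ((2 : ℝ) • (∑ i, fun z : ℂ => ‖z - b i‖⁻¹) +
        (450 * Real.pi * R ^ 2) • fun _ : ℂ => (1 : ℝ)) (ENNReal.ofReal r) μ := by
    refine eLpNorm_mono_ae_real ?_
    filter_upwards [ae_restrict_mem Metric.isOpen_ball.measurableSet] with z hz
    simpa using hu z hz
  have h2 : eLpNorm (∑ i, fun z : ℂ => ‖z - b i‖⁻¹) (ENNReal.ofReal r) μ ≤
      ENNReal.ofReal (n * (A + Real.pi * R ^ 2)) := by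
    refine (eLpNorm_sum_le (fun i _ => (hmeas i).aestronglyMeasurable) hp).trans ?_
    refine (Finset.sum_le_sum fun i _ => hA (b i) z₀ R hR).trans (le_of_eq ?_)
    rw [Finset.sum_const, Finset.card_univ, Fintype.card_fin, nsmul_eq_mul,
      ENNReal.ofReal_mul (Nat.cast_nonneg n), ENNReal.ofReal_natCast]
  have hmeas' : Measurable (∑ i, fun z : ℂ => ‖z - b i‖⁻¹) := by
    convert Finset.univ.measurable_fun_sum fun i _ => hmeas i using 1
    ext
    simp
  refine h1.trans ((eLpNorm_add_le (hmeas'.const_smul (2 : ℝ)).aestronglyMeasurable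
    (measurable_const.const_smul _).aestronglyMeasurable hp).trans ?_)
  rw [eLpNorm_const_smul, eLpNorm_const_smul, Real.enorm_of_nonneg zero_le_two,
    Real.enorm_of_nonneg (by positivity)]
  refine (add_le_add (mul_le_mul_right h2 _)
    (mul_le_mul_right (eLpNorm_one_ball_le hr1 z₀ hR) _)).trans ?_
  rw [← ENNReal.ofReal_mul zero_le_two, ← ENNReal.ofReal_mul (by positivity),
    ← ENNReal.ofReal_add (by positivity) (by positivity)]
  refine ENNReal.ofReal_le_ofReal ?_
  have hR2 : R ^ 2 ≤ R ^ 4 := pow_le_pow_right₀ hR (by norm_num)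
  have h3 : n * (A + Real.pi * R ^ 2) ≤ 32 * Real.pi * R ^ 2 * (A + Real.pi * R ^ 2) := by
    gcongr
  have h4 : Real.pi * A * R ^ 2 ≤ Real.pi * A * R ^ 4 := by gcongr
  nlinarith

/-! ### Logarithmic gradients -/

/-- Passing to the modulus does not increase the logarithmic gradient. -/
theorem norm_logGradient_norm_le {F : ℂ → ℂ} {z : ℂ} (hF : DifferentiableAt ℝ F z) :
    ‖logGradient (fun w => ((‖F w‖ : ℝ) : ℂ)) z‖ ≤ ‖logGradient F z‖ := by
  by_cases h0 : F z = 0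
  · have : logGradient (fun w => ((‖F w‖ : ℝ) : ℂ)) z = 0 := by
      ext i; fin_cases i <;> simp [logGradient, h0]
    rw [this, norm_zero]
    exact norm_nonneg _
  have key : ∀ v : ℂ, ‖fderiv ℝ (fun w => ((‖F w‖ : ℝ) : ℂ)) z v‖ ≤ ‖fderiv ℝ F z v‖ := by
    intro v
    have h1 : DifferentiableAt ℝ (fun w : ℂ => ‖w‖) (F z) := differentiableAt_id.norm ℝ h0
    have h2 := (Complex.ofRealCLM.hasFDerivAt (x := ‖F z‖)).comp z
      (h1.hasFDerivAt.comp z hF.hasFDerivAt)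
    have h3 : fderiv ℝ (fun w => ((‖F w‖ : ℝ) : ℂ)) z = _ := h2.fderiv
    rw [h3]
    simp only [ContinuousLinearMap.comp_apply, Complex.ofRealCLM_apply, Complex.norm_real]
    refine ((fderiv ℝ (fun w : ℂ => ‖w‖) (F z)).le_opNorm _).trans ?_
    refine mul_le_of_le_one_left (norm_nonneg _) ?_
    simpa using norm_fderiv_le_of_lipschitz ℝ (lipschitzWith_one_norm (E := ℂ)) (x₀ := F z)
  rw [EuclideanSpace.norm_eq, EuclideanSpace.norm_eq]
  refine Real.sqrt_le_sqrt ?_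
  simp only [logGradient, Fin.sum_univ_two, Matrix.cons_val_zero, Matrix.cons_val_one,
    norm_div, Complex.norm_real, norm_norm]
  gcongr <;> exact key _

/-- The logarithmic gradient of a function `e^{-π(x - x₀)²} H(conj (z - z₀))` with `H`
holomorphic. -/
theorem norm_logGradient_gaussian_mul_le {H : ℂ → ℂ} (hH : Differentiable ℂ H) {K : ℂ}
    (z₀ z : ℂ) {F : ℂ → ℂ}
    (hF : ∀ z, F z = K * Complex.exp (-Real.pi * (z.re - z₀.re : ℝ) ^ 2) *
      H ((starRingEnd ℂ) (z - z₀))) :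
    DifferentiableAt ℝ F z ∧ (F z ≠ 0 → ‖logGradient F z‖ ≤
      2 * Real.pi * ‖z - z₀‖ + 2 * ‖logDeriv H ((starRingEnd ℂ) (z - z₀))‖) := by
  set ζ := (starRingEnd ℂ) (z - z₀) with hζ
  have h2 : HasFDerivAt (fun w : ℂ => (starRingEnd ℂ) (w - z₀))
      (Complex.conjCLE : ℂ →L[ℝ] ℂ) z := by
    have h := (Complex.conjCLE.hasFDerivAt (x := z - z₀)).comp z
      ((hasFDerivAt_id z).sub_const z₀)
    exact h.congr_fderiv (by ext; simp)
  have h3 := ((hH ζ).hasDerivAt.hasFDerivAt.restrictScalars ℝ).comp z h2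
  have h4 : HasFDerivAt (fun w : ℂ => -Real.pi * (w.re - z₀.re) ^ 2)
      ((-Real.pi * (2 * (z.re - z₀.re))) • Complex.reCLM) z := by
    have h := ((Complex.reCLM.hasFDerivAt (x := z)).sub_const z₀.re).pow 2 |>.const_mul (-Real.pi)
    exact h.congr_fderiv (by ext; simp [mul_assoc])
  have h5 := (((Complex.ofRealCLM.hasFDerivAt (x := -Real.pi * (z.re - z₀.re) ^ 2)).comp z
    h4).cexp.const_mul K).mul h3
  have hFeq : F = fun w => K * Complex.exp ((-Real.pi * (w.re - z₀.re) ^ 2 : ℝ) : ℂ) *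
      H ((starRingEnd ℂ) (w - z₀)) := by
    funext w
    rw [hF]
    push_cast
    rfl
  have h6 := h5
  rw [show ((fun y => K * Complex.exp ((Complex.ofRealCLM ∘ fun w : ℂ =>
    -Real.pi * (w.re - z₀.re) ^ 2) y)) * H ∘ fun w => (starRingEnd ℂ) (w - z₀)) = F from
    hFeq.symm] at h6
  refine ⟨h6.differentiableAt, fun hne => ?_⟩
  set E : ℂ := K * Complex.exp ((-Real.pi * (z.re - z₀.re) ^ 2 : ℝ) : ℂ) with hE
  have hFz : F z = E * H ζ := by rw [hFeq]
  rw [hFz] at hne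
  have hE0 := left_ne_zero_of_mul hne
  have hH0 := right_ne_zero_of_mul hne
  have hζ' : (starRingEnd ℂ) z - (starRingEnd ℂ) z₀ = ζ := (map_sub _ _ _).symm
  have hE' : E = K * Complex.exp (-(Real.pi * (z.re - z₀.re) ^ 2)) := by
    rw [hE]
    push_cast
    rw [neg_mul]
  have q1 : fderiv ℝ F z 1 / F z =
      -2 * Real.pi * ((z.re - z₀.re : ℝ) : ℂ) + logDeriv H ζ := by
    rw [h6.fderiv, hFz, logDeriv_apply, div_eq_iff hne]
    simp
    rw [hζ', hE']
    field_simp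
    ring
  have q2 : fderiv ℝ F z Complex.I / F z = -Complex.I * logDeriv H ζ := by
    rw [h6.fderiv, hFz, logDeriv_apply, div_eq_iff hne]
    simp
    rw [hE']
    field_simp
  have hre : |z.re - z₀.re| ≤ ‖z - z₀‖ := by simpa using Complex.abs_re_le_norm (z - z₀)
  have n1 : ‖fderiv ℝ F z 1 / F z‖ ≤ 2 * Real.pi * ‖z - z₀‖ + ‖logDeriv H ζ‖ := by
    rw [q1]
    refine (norm_add_le _ _).trans ?_
    gcongr
    simp only [norm_mul, norm_neg, Complex.norm_real, Complex.norm_ofNat,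
      Real.norm_of_nonneg Real.pi_pos.le, Real.norm_eq_abs]
    gcongr
  have n2 : ‖fderiv ℝ F z Complex.I / F z‖ = ‖logDeriv H ζ‖ := by
    rw [q2, norm_mul, norm_neg, Complex.norm_I, one_mul]
  rw [EuclideanSpace.norm_eq]
  simp only [logGradient, Fin.sum_univ_two, Matrix.cons_val_zero, Matrix.cons_val_one]
  rw [n2]
  refine Real.sqrt_le_iff.2 ⟨by positivity, ?_⟩
  have := norm_nonneg (fderiv ℝ F z 1 / F z)
  nlinarith [norm_nonneg (logDeriv H ζ), Real.pi_pos, norm_nonneg (z - z₀),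
    mul_nonneg Real.pi_pos.le (norm_nonneg (z - z₀))]

/-- The Gabor transform, modulated and recentered at a point `z₀` where its modulus is maximal, is
a Gaussian times an entire function `H` of `conj (z - z₀)`. Maximality at `z₀` gives
`‖H ζ‖ ≤ e^{π‖ζ‖²}` and `‖H 0‖ = 1`, uniformly in `f` and `z₀`. -/
theorem exists_entire_gaborTransform_eq (f : 𝓢'(ℝ, ℂ)) {z₀ : ℂ}
    (hmax : IsMaxOn (fun z => ‖gaborTransform f z‖) Set.univ z₀)
    (h0 : gaborTransform f z₀ ≠ 0) :
    ∃ (K : ℂ) (H : ℂ → ℂ), Differentiable ℂ H ∧ ‖H 0‖ = 1 ∧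
      (∀ ζ, ‖H ζ‖ ≤ Real.exp (Real.pi * ‖ζ‖ ^ 2)) ∧
      ∀ z, Complex.exp (2 * Real.pi * Complex.I * z₀.re * z.im) * gaborTransform f z =
        K * Complex.exp (-Real.pi * (z.re - z₀.re : ℝ) ^ 2) * H ((starRingEnd ℂ) (z - z₀)) := by
  set w₀ := (starRingEnd ℂ) z₀ with hw₀
  set G : ℂ → ℂ := fun w => f (gaussianAtom w) with hG
  have hGd : Differentiable ℂ G := differentiable_apply_gaussianAtom f
  have hG0 : G w₀ ≠ 0 := fun h => h0 (by rw [gaborTransform_eq, ← hw₀]; simp [hG ▸ h])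
  set K : ℂ := Complex.exp (2 * Real.pi * Complex.I * z₀.re * z₀.im - Real.pi * z₀.re ^ 2) * G w₀
    with hK
  have hK0 : K ≠ 0 := mul_ne_zero (Complex.exp_ne_zero _) hG0
  set H : ℂ → ℂ := fun ζ => Complex.exp (-2 * Real.pi * z₀.re * ζ) * G (w₀ + ζ) / G w₀ with hH
  have hHd : Differentiable ℂ H := by rw [hH]; fun_prop
  have hH0 : H 0 = 1 := by simp [hH, hG0]
  have hident : ∀ z, Complex.exp (2 * Real.pi * Complex.I * z₀.re * z.im) * gaborTransform f z =
      K * Complex.exp (-Real.pi * (z.re - z₀.re : ℝ) ^ 2) * H ((starRingEnd ℂ) (z - z₀)) := by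
    intro z
    have e1 : w₀ + (starRingEnd ℂ) (z - z₀) = (starRingEnd ℂ) z := by simp [hw₀]
    have e2 : (starRingEnd ℂ) (z - z₀) = (z.re - z₀.re) - (z.im - z₀.im) * Complex.I := by
      apply Complex.ext <;> simp
      ring
    simp only [hH, hK]
    rw [e1, gaborTransform_eq, e2]
    have e3 : Complex.exp (2 * Real.pi * Complex.I * z₀.re * z.im) *
        Complex.exp (-Real.pi * z.re ^ 2) =
        Complex.exp (2 * Real.pi * Complex.I * z₀.re * z₀.im - Real.pi * z₀.re ^ 2) *
          Complex.exp (-Real.pi * (z.re - z₀.re : ℝ) ^ 2) * Complex.exp (-2 * Real.pi * z₀.re *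
            ((z.re - z₀.re) - (z.im - z₀.im) * Complex.I)) := by
      rw [← Complex.exp_add, ← Complex.exp_add, ← Complex.exp_add]
      congr 1
      push_cast
      ring
    have e4 : ((Real.exp (-Real.pi * z.re ^ 2) : ℝ) : ℂ) = Complex.exp (-Real.pi * z.re ^ 2) := by
      push_cast; rfl
    rw [e4, ← mul_assoc, e3, mul_div_assoc', eq_div_iff hG0]
    simp only [hG]
    ring
  have hnorm : ∀ z, ‖gaborTransform f z‖ = ‖K‖ *
      Real.exp (-Real.pi * (z.re - z₀.re) ^ 2) * ‖H ((starRingEnd ℂ) (z - z₀))‖ := by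
    intro z
    have h := congrArg norm (hident z)
    have e1 : ‖Complex.exp (2 * Real.pi * Complex.I * z₀.re * z.im)‖ = 1 := by
      rw [Complex.norm_exp]; simp
    have e2 : Complex.exp (-Real.pi * (z.re - z₀.re : ℝ) ^ 2) =
        (Real.exp (-Real.pi * (z.re - z₀.re) ^ 2) : ℝ) := by push_cast; rfl
    rwa [norm_mul, e1, one_mul, norm_mul, norm_mul, e2, Complex.norm_real,
      Real.norm_of_nonneg (Real.exp_pos _).le] at h
  refine ⟨K, H, hHd, by simp [hH0], fun ζ => ?_, hident⟩
  set z := z₀ + (starRingEnd ℂ) ζ with hz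
  have h1 : ‖gaborTransform f z‖ ≤ ‖gaborTransform f z₀‖ := hmax (Set.mem_univ z)
  rw [hnorm z, hnorm z₀] at h1
  have e1 : (starRingEnd ℂ) (z - z₀) = ζ := by simp [hz]
  have e2 : z.re - z₀.re = ζ.re := by simp [hz]
  rw [e1, e2, sub_self, sub_self, map_zero, hH0] at h1
  have h2 : Real.exp (-Real.pi * ζ.re ^ 2) * ‖H ζ‖ ≤ 1 := by
    have hKpos := norm_pos_iff.2 hK0
    rw [mul_assoc] at h1
    simpa using le_of_mul_le_mul_left (h1.trans (by simp : _ ≤ ‖K‖ * 1)) hKpos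
  have h3 : ‖H ζ‖ ≤ Real.exp (Real.pi * ζ.re ^ 2) := by
    have := mul_le_mul_of_nonneg_left h2 (Real.exp_pos (Real.pi * ζ.re ^ 2)).le
    rwa [← mul_assoc, ← Real.exp_add, neg_mul, add_neg_cancel, Real.exp_zero, one_mul,
      mul_one] at this
  refine h3.trans (Real.exp_le_exp.2 ?_)
  have : ζ.re ^ 2 ≤ ‖ζ‖ ^ 2 := by
    rw [← sq_abs]
    exact pow_le_pow_left₀ (abs_nonneg _) (Complex.abs_re_le_norm ζ) 2
  gcongr

theorem mainTheorem4 (r : ℝ) (hr1 : 1 ≤ r) (hr2 : r < 2) :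
    ∃ ρ : Polynomial ℝ, ρ.natDegree ≤ 5 ∧
      ∀ f ∈ modulationSpace ∞, f ≠ 0 →
        ∀ z₀ : ℂ, IsMaxOn (fun z => ‖gaborTransform f z‖) Set.univ z₀ →
          ∀ R : ℝ, 0 < R →
            (z₀.re = 0 →
              MeasureTheory.eLpNorm (logGradient (gaborTransform f)) (ENNReal.ofReal r)
                (MeasureTheory.volume.restrict (Metric.ball z₀ R)) ≤
                  ENNReal.ofReal (ρ.eval R)) ∧
            MeasureTheory.eLpNorm
                (logGradient fun z =>
                  Complex.exp (2 * Real.pi * Complex.I * z₀.re * z.im) * gaborTransform f z)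
                (ENNReal.ofReal r)
                (MeasureTheory.volume.restrict (Metric.ball z₀ R)) ≤
              ENNReal.ofReal (ρ.eval R) ∧
            MeasureTheory.eLpNorm
                (logGradient fun z => ((‖gaborTransform f z‖ : ℝ) : ℂ))
                (ENNReal.ofReal r)
                (MeasureTheory.volume.restrict (Metric.ball z₀ R)) ≤
              ENNReal.ofReal (ρ.eval R) := by
  obtain ⟨A, hA0, hA⟩ := exists_eLpNorm_inv_norm_sub_le hr1 hr2
  set c : ℝ := Real.pi * (64 * A + 514 * Real.pi) with hc
  have hc0 : 0 ≤ c := by positivity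
  refine ⟨Polynomial.C c * (1 + Polynomial.X) ^ 4, ?_, fun f _ _ z₀ hmax R hR => ?_⟩
  · refine (Polynomial.natDegree_C_mul_le _ _).trans (Polynomial.natDegree_pow_le.trans ?_)
    have : (1 + Polynomial.X : Polynomial ℝ).natDegree ≤ 1 := by
      rw [add_comm, ← Polynomial.C_1, Polynomial.natDegree_X_add_C]
    omega
  have heval : (Polynomial.C c * (1 + Polynomial.X) ^ 4).eval R = c * (1 + R) ^ 4 := by simp
  rw [heval]
  set F : ℂ → ℂ := fun z =>
    Complex.exp (2 * Real.pi * Complex.I * z₀.re * z.im) * gaborTransform f z with hF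
  have hFnorm : ∀ z, ‖F z‖ = ‖gaborTransform f z‖ := by
    intro z
    rw [hF]
    simp only [norm_mul, Complex.norm_exp]
    simp
  -- a single pointwise bound on the disc of radius `1 + R` serves both `F` and `‖F‖`
  suffices h : ∃ (n : ℕ) (b : Fin n → ℂ), (n : ℝ) ≤ 32 * Real.pi * (1 + R) ^ 2 ∧
      ∀ z ∈ Metric.ball z₀ (1 + R),
        ‖logGradient F z‖ ≤ 2 * ∑ i, ‖z - b i‖⁻¹ + 450 * Real.pi * (1 + R) ^ 2 ∧
        ‖logGradient (fun w => ((‖F w‖ : ℝ) : ℂ)) z‖ ≤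
          2 * ∑ i, ‖z - b i‖⁻¹ + 450 * Real.pi * (1 + R) ^ 2 by
    obtain ⟨n, b, hn, hb⟩ := h
    have hmono : MeasureTheory.volume.restrict (Metric.ball z₀ R) ≤
        MeasureTheory.volume.restrict (Metric.ball z₀ (1 + R)) :=
      MeasureTheory.Measure.restrict_mono (Metric.ball_subset_ball (by linarith)) le_rfl
    have h1 := (MeasureTheory.eLpNorm_mono_measure (logGradient F) hmono).trans
      (eLpNorm_le_of_poles hr1 hA0 hA (by linarith) hn b fun z hz => (hb z hz).1)
    have h2 := (MeasureTheory.eLpNorm_mono_measure _ hmono).trans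
      (eLpNorm_le_of_poles hr1 hA0 hA (by linarith) hn b fun z hz => (hb z hz).2)
    refine ⟨fun hz₀ => ?_, h1, ?_⟩
    · have : F = gaborTransform f := by
        funext z
        simp [hF, hz₀]
      rwa [this] at h1
    · simpa only [hFnorm] using h2
  by_cases h0 : gaborTransform f z₀ = 0
  · -- the maximum being zero, all logarithmic gradients vanish by convention
    have hzero : ∀ z, gaborTransform f z = 0 := fun z => by
      have : ‖gaborTransform f z‖ ≤ ‖gaborTransform f z₀‖ := hmax (Set.mem_univ z)
      simpa [h0] using this
    refine ⟨0, Fin.elim0, by simp; positivity, fun z _ => ?_⟩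
    have e1 : logGradient F z = 0 := by
      ext i; fin_cases i <;> simp [logGradient, hF, hzero]
    have e2 : logGradient (fun w => ((‖F w‖ : ℝ) : ℂ)) z = 0 := by
      ext i; fin_cases i <;> simp [logGradient, hF, hzero]
    rw [e1, e2]
    simp only [norm_zero, and_self]
    positivity
  obtain ⟨K, H, hHd, hH0, hHg, hident⟩ := exists_entire_gaborTransform_eq f hmax h0
  obtain ⟨n, a, hn, ha⟩ := exists_poles_norm_logDeriv_le hHd hHg hH0 (R := 1 + R) (by linarith)
  refine ⟨n, fun i => z₀ + (starRingEnd ℂ) (a i), hn, fun z hz => ?_⟩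
  obtain ⟨hd, hgrad⟩ := norm_logGradient_gaussian_mul_le hHd z₀ z hident
  have main : ‖logGradient F z‖ ≤ 2 * ∑ i, ‖z - (z₀ + (starRingEnd ℂ) (a i))‖⁻¹ +
      450 * Real.pi * (1 + R) ^ 2 := by
    have hzR : ‖z - z₀‖ ≤ 1 + R := (mem_ball_iff_norm.1 hz).le
    by_cases hFz : F z = 0
    · have e1 : logGradient F z = 0 := by
        ext i; fin_cases i <;> simp [logGradient, hFz]
      rw [e1, norm_zero]
      positivity
    have hFz' : K * Complex.exp (-Real.pi * (z.re - z₀.re : ℝ) ^ 2) *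
        H ((starRingEnd ℂ) (z - z₀)) ≠ 0 := by rw [← hident]; exact hFz
    have h1 := ha ((starRingEnd ℂ) (z - z₀)) (by rwa [Complex.norm_conj])
      (right_ne_zero_of_mul hFz')
    have h2 : ∀ i, ‖(starRingEnd ℂ) (z - z₀) - a i‖ = ‖z - (z₀ + (starRingEnd ℂ) (a i))‖ := by
      intro i
      rw [← Complex.norm_conj, map_sub, Complex.conj_conj, sub_sub]
    simp only [h2] at h1
    refine (hgrad hFz).trans ?_
    have h3 : ‖z - z₀‖ ≤ (1 + R) ^ 2 := by nlinarith
    -- the constant is `450 = 2 + 2 * 224`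
    nlinarith [mul_le_mul_of_nonneg_left h3 Real.pi_pos.le]
  exact ⟨main, (norm_logGradient_norm_le hd).trans main⟩
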